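/- Equip $\mathbb{C}^3$ with the Hermitian product $\langle z,w\rangle=\overline{z_1}w_3+\overline{z_2}w_2+\overline{z_3}w_1$ of signature $(2,1)$. Let $\mathbf{H}^2_{\mathbb{C}}\subset\mathbb{CP}^2$ be the set of lines $[v]$ with $\langle v,v\rangle<0$, and $\partial_\infty\mathbf{H}^2_{\mathbb{C}}$ the set of lines $[v]$, $v\neq 0$, with $\langle v,v\rangle=0$. An $\mathbb{R}$-circle is the boundary at infinity of a real plane, that is, a set of the form $\{[v]\in\partial_\infty\mathbf{H}^2_{\mathbb{C}} : v\in L\setminus\{0\}\}$, where $L\subset\mathbb{C}^3$ is a real subspace of real dimension $3$ with $L\cap iL=0$ on which $\langle\cdot,\cdot\rangle$ takes real values. The limit set of a discrete subgroup of $\mathrm{SU}(2,1)$ is the set of accumulation points in $\mathbb{CP}^2$ of the orbit of any point of $\mathbf{H}^2_{\mathbb{C}}$. Let $\zeta=e^{i\pi/3}=\frac{1+i\sqrt3}{2}$ and $$S=\begin{pmatrix}1&\sqrt2\,\overline{\zeta}&-1\\-\sqrt2\,\zeta&-1&0\\-1&0&0\end{pmatrix},\qquad T=\begin{pmatrix}0&0&-1\\0&-1&-\sqrt2\,\overline{\zeta}\\-1&\sqrt2\,\zeta&1\end{pmatrix},$$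 which belong to $\mathrm{SU}(2,1)$, and let $\Gamma_6=\langle S,T\rangle$, $A=ST$, $B=TS$, $V=TS^{-1}$, $B_1=AB^2A^{-1}$ and $[p_B]=[0:0:1]$, the fixed point of $B$ in $\partial_\infty\mathbf{H}^2_{\mathbb{C}}$. Let $\Gamma'=\langle B,V^3BV^{-3}\rangle$. **Proposition.** One has $V^3BV^{-3}B=B_1$, $\Gamma'=\langle B,AB^2A^{-1}\rangle$ and $\Gamma'\le\Gamma_6$. There is exactly one $\mathbb{R}$-circle $R_0$ through the three points $[p_B]$, $B_1[p_B]$ and $B_1^{-1}[p_B]$. It is preserved by $\Gamma'$ (that is, $gR_0=R_0$ for every $g\in\Gamma'$), and the limit set of $\Gamma'$ is exactly $R_0$: for every point $x\in\mathbf{H}^2_{\mathbb{C}}$, the set of accumulation points of the orbit $\Gamma' x$ is $R_0$. -/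

import Mathlib

namespace CHyp

/-- The Hermitian product `⟨z, w⟩ = conj z₁ w₃ + conj z₂ w₂ + conj z₃ w₁` of signature `(2,1)`
on `ℂ³`. -/
noncomputable def herm (z w : Fin 3 → ℂ) : ℂ :=
  star (z 0) * w 2 + star (z 1) * w 1 + star (z 2) * w 0

/-- The complex projective plane. -/
abbrev CP2 : Type := Projectivization ℂ (Fin 3 → ℂ)

/-- The usual topology on the projective plane: the quotient topology from `ℂ³ \ {0}`. -/
noncomputable instance instTopologicalSpaceCP2 : TopologicalSpace CP2 :=
  TopologicalSpace.coinduced (Projectivization.mk' ℂ) inferInstance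

/-- The complex hyperbolic plane, the set of negative lines (`⟨v, v⟩` is always real). -/
def HC2 : Set CP2 :=
  {p | ∃ (v : Fin 3 → ℂ) (hv : v ≠ 0), (herm v v).re < 0 ∧ p = Projectivization.mk ℂ v hv}

/-- The boundary at infinity of the complex hyperbolic plane, the set of null lines. -/
def bdHC2 : Set CP2 :=
  {p | ∃ (v : Fin 3 → ℂ) (hv : v ≠ 0), herm v v = 0 ∧ p = Projectivization.mk ℂ v hv}

/-- The group `SU(2,1)`. -/
def SU21 : Subgroup (Matrix.SpecialLinearGroup (Fin 3) ℂ) where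
  carrier := {g | ∀ z w : Fin 3 → ℂ, herm (g • z) (g • w) = herm z w}
  mul_mem' := by
    intro a b ha hb z w
    rw [mul_smul, mul_smul, ha, hb]
  one_mem' := by
    intro z w
    rw [one_smul, one_smul]
  inv_mem' := by
    intro a ha z w
    have h := ha (a⁻¹ • z) (a⁻¹ • w)
    rw [smul_inv_smul, smul_inv_smul] at h
    exact h.symm

/-- A real subspace `L` of `ℂ³` of real dimension `3` that is totally real (`L ∩ iL = 0`) and on
which the Hermitian product takes real values: the real planes of the complex hyperbolic plane are
the sets of negative lines spanned by the vectors of such an `L`. -/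
def IsTotallyReal (L : Submodule ℝ (Fin 3 → ℂ)) : Prop :=
  Module.finrank ℝ L = 3 ∧ (∀ v ∈ L, Complex.I • v ∈ L → v = 0) ∧
    ∀ v ∈ L, ∀ w ∈ L, (herm v w).im = 0

/-- An `ℝ`-circle: the boundary at infinity of a real plane. -/
def IsRCircle (R : Set CP2) : Prop :=
  ∃ L : Submodule ℝ (Fin 3 → ℂ), IsTotallyReal L ∧
    R = {p | p ∈ bdHC2 ∧ ∃ (v : Fin 3 → ℂ) (hv : v ≠ 0), v ∈ L ∧ p = Projectivization.mk ℂ v hv}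

/-- The orbit of `x` under a group of matrices acting on the projective plane. -/
def orbitOf (Γ : Subgroup (Matrix.SpecialLinearGroup (Fin 3) ℂ)) (x : CP2) : Set CP2 :=
  {y | ∃ g ∈ Γ, y = g • x}

/-- `Λ` is the limit set of `Γ`: it is the set of accumulation points of the `Γ`-orbit of every
point of the complex hyperbolic plane. -/
def IsLimitSet (Γ : Subgroup (Matrix.SpecialLinearGroup (Fin 3) ℂ)) (Λ : Set CP2) : Prop :=
  ∀ x ∈ HC2, derivedSet (orbitOf Γ x) = Λ

/-- `ζ = exp (iπ/3) = (1 + i√3)/2`. -/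
noncomputable def zeta : ℂ := (1 + Complex.I * (√3 : ℝ)) / 2

/-- The generator `S`. -/
noncomputable def genS : Matrix.SpecialLinearGroup (Fin 3) ℂ :=
  ⟨!![1, (√2 : ℝ) * star zeta, -1;
      -((√2 : ℝ) * zeta), -1, 0;
      -1, 0, 0], by
    rw [Matrix.det_fin_three]; simp⟩

/-- The generator `T`. -/
noncomputable def genT : Matrix.SpecialLinearGroup (Fin 3) ℂ :=
  ⟨!![0, 0, -1;
      0, -1, -((√2 : ℝ) * star zeta);
      -1, (√2 : ℝ) * zeta, 1], by
    rw [Matrix.det_fin_three]; simp⟩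

/-- The group `Γ₆ = ⟨S, T⟩`. -/
noncomputable def Gamma6 : Subgroup (Matrix.SpecialLinearGroup (Fin 3) ℂ) :=
  Subgroup.closure {genS, genT}

/-- `A = ST`. -/
noncomputable def elA : Matrix.SpecialLinearGroup (Fin 3) ℂ := genS * genT

/-- `B = TS`. -/
noncomputable def elB : Matrix.SpecialLinearGroup (Fin 3) ℂ := genT * genS

/-- `V = TS⁻¹`. -/
noncomputable def elV : Matrix.SpecialLinearGroup (Fin 3) ℂ := genT * genS⁻¹

/-- `B₁ = AB²A⁻¹`. -/
noncomputable def elB₁ : Matrix.SpecialLinearGroup (Fin 3) ℂ := elA * elB ^ 2 * elA⁻¹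

/-- The group `Γ' = ⟨B, V³BV⁻³⟩`. -/
noncomputable def GammaPrime : Subgroup (Matrix.SpecialLinearGroup (Fin 3) ℂ) :=
  Subgroup.closure {elB, elV ^ 3 * elB * (elV ^ 3)⁻¹}

/-- The point `[p_B] = [0 : 0 : 1]`, the fixed point of `B` on the boundary at infinity. -/
noncomputable def pB : CP2 :=
  Projectivization.mk ℂ ![0, 0, 1] (fun h => by simpa using congrFun h 2)

theorem zeta_mul_star : zeta * star zeta = 1 := by
  have h3 : ((√3 : ℝ) : ℂ) * (√3 : ℝ) = 3 := by
    rw [← Complex.ofReal_mul, Real.mul_self_sqrt (by norm_num)]; norm_num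
  simp only [zeta, Complex.star_def, map_div₀, map_add, map_mul, map_one, Complex.conj_I,
    Complex.conj_ofReal, map_ofNat]
  linear_combination (-(Complex.I * Complex.I) / 4) * h3 - (3 / 4 : ℂ) * Complex.I_mul_I

theorem sqrt_two_sq : ((√2 : ℝ) : ℂ) * (√2 : ℝ) = 2 := by
  rw [← Complex.ofReal_mul, Real.mul_self_sqrt (by norm_num)]; norm_num

theorem genS_mem : genS ∈ SU21 := by
  intro z w
  have hz := zeta_mul_star
  have h2 := sqrt_two_sq
  change herm (genS.1.mulVec z) (genS.1.mulVec w) = herm z w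
  simp only [genS, herm, Matrix.mulVec,
    dotProduct, Fin.sum_univ_three, Matrix.of_apply, Matrix.cons_val', Matrix.cons_val_zero,
    Matrix.cons_val_one, Matrix.cons_val, Complex.star_def, map_add, map_mul, map_neg, map_one,
    map_zero, Complex.conj_conj, Complex.conj_ofReal] at hz ⊢
  linear_combination (starRingEnd ℂ (z 0)) * w 0 * (zeta * (starRingEnd ℂ) zeta) * h2
    + 2 * (starRingEnd ℂ (z 0)) * w 0 * hz

theorem genT_mem : genT ∈ SU21 := by
  intro z w
  have hz := zeta_mul_star
  have h2 := sqrt_two_sq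
  change herm (genT.1.mulVec z) (genT.1.mulVec w) = herm z w
  simp only [genT, herm, Matrix.mulVec,
    dotProduct, Fin.sum_univ_three, Matrix.of_apply, Matrix.cons_val', Matrix.cons_val_zero,
    Matrix.cons_val_one, Matrix.cons_val, Complex.star_def, map_add, map_mul, map_neg, map_one,
    map_zero, Complex.conj_conj, Complex.conj_ofReal] at hz ⊢
  linear_combination (starRingEnd ℂ (z 2)) * w 2 * (zeta * (starRingEnd ℂ) zeta) * h2
    + 2 * (starRingEnd ℂ (z 2)) * w 2 * hz

theorem Gamma6_le_SU21 : Gamma6 ≤ SU21 := by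
  rw [Gamma6, Subgroup.closure_le]
  rintro g (rfl | rfl)
  · exact genS_mem
  · exact genT_mem

end CHyp

namespace CHyp

open Matrix Filter Topology

/-! In suitable coordinates on `ℂ³`, `Γ'` acts through the symmetric square of `SL₂`: identify a
vector with the symmetric matrix `X = (x₀, x₁; x₁, x₂)`; then `B` and `C = V³BV⁻³` act by `X ↦ M X
Mᵀ` with `M = (1, 2; 0, 1)` and `M = (1, 0; -2, 1)` (`elB_smul`, `elC_smul`), and the Hermitian
product becomes `-4` times the polarized determinant (`herm_symCoord`). Real symmetric matrices
therefore span a real plane, whose boundary is the Veronese conic of real rank-one matrices, a copy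
of the real projective line preserved by `Γ'`.

Uniqueness (`IsRCircle.eq_veroneseCircle`): reality of the Hermitian product forces representatives
in `L` of the three given points to be real matrices up to one common scalar. Since the three
matrices are a basis, `L` is determined up to that scalar.

Accumulation points lie on the conic because `Γ'` acts by integral matrices: `defect` is invariant
and vanishes exactly over the conic, and only finitely many orbit points keep a normalized defect
above a given `δ > 0` (`finite_orbitOf_inter`).

Conversely, `Bⁿx` tends to `[p_B]`, so the whole `Γ'`-orbit of `[p_B]` consists of accumulation
points. A Euclidean algorithm with even steps (`exists_smul_eq_of_isCoprime`) puts every odd/even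
fraction in this orbit. These are dense in the circle and derived sets are closed. -/

/-! ### Matrices of the generators, and relations among them -/

theorem star_zeta : star zeta = 1 - zeta := by
  simp only [zeta, Complex.star_def, map_div₀, map_add, map_mul, map_one, Complex.conj_I,
    Complex.conj_ofReal, map_ofNat]
  ring

theorem zeta_sq : zeta ^ 2 = zeta - 1 := by
  linear_combination -zeta_mul_star + zeta * star_zeta

theorem coe_elB :
    (elB : Matrix (Fin 3) (Fin 3) ℂ) =
      !![1, 0, 0; ((√2 : ℝ) : ℂ), 1, 0; -2 * zeta, -(√2 : ℝ), 1] := by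
  have hz := zeta_sq
  have h2 := sqrt_two_sq
  change genT.1 * genS.1 = _
  simp only [genS, genT, star_zeta]
  ext i j
  fin_cases i <;> fin_cases j <;> simp [Matrix.mul_apply, Fin.sum_univ_three] <;> grind

theorem coe_elA :
    (elA : Matrix (Fin 3) (Fin 3) ℂ) =
      !![1, -((√2 : ℝ) : ℂ), -2 + 2 * zeta; 0, 1, (√2 : ℝ); 0, 0, 1] := by
  have hz := zeta_sq
  have h2 := sqrt_two_sq
  change genS.1 * genT.1 = _
  simp only [genS, genT, star_zeta]
  ext i j
  fin_cases i <;> fin_cases j <;> simp [Matrix.mul_apply, Fin.sum_univ_three] <;> grind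

theorem coe_elV :
    (elV : Matrix (Fin 3) (Fin 3) ℂ) =
      !![1, (√2 : ℝ) * (1 - zeta), -1; (√2 : ℝ) * (1 - zeta), 1 - 2 * zeta, -(√2 : ℝ);
      -1, -(√2 : ℝ), 2 * zeta] := by
  have hz := zeta_sq
  have h2 := sqrt_two_sq
  change genT.1 * adjugate genS.1 = _
  simp only [genS, genT, star_zeta, adjugate_fin_three]
  ext i j
  fin_cases i <;> fin_cases j <;> simp [Matrix.mul_apply, Fin.sum_univ_three] <;> grind

theorem coe_elV_pow_three :
    (↑(elV ^ 3) : Matrix (Fin 3) (Fin 3) ℂ) = !![3 - 4 * zeta, -2 * (√2 : ℝ) * zeta, -4;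
      -2 * (√2 : ℝ) * zeta, -3, (√2 : ℝ) * (2 * zeta - 2);
      -4, (√2 : ℝ) * (2 * zeta - 2), 4 * zeta - 1] := by
  have hz := zeta_sq
  have h2 := sqrt_two_sq
  rw [pow_succ, pow_two]
  change elV.1 * elV.1 * elV.1 = _
  rw [coe_elV]
  ext i j
  fin_cases i <;> fin_cases j <;> simp [Matrix.mul_apply, Fin.sum_univ_three] <;> grind

/-- The generator `V³BV⁻³` of `Γ'`. -/
noncomputable def elC : SpecialLinearGroup (Fin 3) ℂ := elV ^ 3 * elB * (elV ^ 3)⁻¹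

theorem coe_elC :
    (elC : Matrix (Fin 3) (Fin 3) ℂ) =
      !![17 - 20 * zeta, (√2 : ℝ) * (-4 - 8 * zeta), -16;
      (√2 : ℝ) * (-5 - 4 * zeta), -11 + 8 * zeta, (√2 : ℝ) * (8 * zeta - 4);
      -12 - 2 * zeta, (√2 : ℝ) * (-7 + 8 * zeta), -3 + 12 * zeta] := by
  have hz := zeta_sq
  have h2 := sqrt_two_sq
  have hinv : (↑(elV ^ 3) : Matrix (Fin 3) (Fin 3) ℂ) *
      (↑((elV ^ 3)⁻¹) : Matrix (Fin 3) (Fin 3) ℂ) = 1 := by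
    exact congrArg Subtype.val (mul_inv_cancel (elV ^ 3))
  -- Testing `V³B = M V³` avoids computing the inverse of `V³`.
  have key : ∀ M : Matrix (Fin 3) (Fin 3) ℂ, (↑(elV ^ 3) : Matrix (Fin 3) (Fin 3) ℂ) *
      (elB : Matrix (Fin 3) (Fin 3) ℂ) = M * (↑(elV ^ 3) : Matrix (Fin 3) (Fin 3) ℂ) →
      (elC : Matrix (Fin 3) (Fin 3) ℂ) = M := by
    intro M hM
    change (elV ^ 3).1 * elB.1 * ((elV ^ 3)⁻¹).1 = M
    rw [hM, Matrix.mul_assoc, hinv,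
      Matrix.mul_one]
  apply key
  rw [coe_elV_pow_three, coe_elB]
  ext i j
  fin_cases i <;> fin_cases j <;> simp [Matrix.mul_apply, Fin.sum_univ_three] <;> grind

theorem elC_mul_elB : elC * elB = elB₁ := by
  have hz := zeta_sq
  have h2 := sqrt_two_sq
  rw [elB₁, eq_mul_inv_iff_mul_eq]
  apply Subtype.ext
  rw [pow_two]
  change elC.1 * elB.1 * elA.1 = elA.1 * (elB.1 * elB.1)
  rw [coe_elC, coe_elA, coe_elB]
  ext i j
  fin_cases i <;> fin_cases j <;> simp [Matrix.mul_apply, Fin.sum_univ_three] <;> grind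

theorem elB_mem : elB ∈ GammaPrime := Subgroup.subset_closure (Or.inl rfl)

theorem elC_mem : elC ∈ GammaPrime := Subgroup.subset_closure (Or.inr rfl)

theorem elB₁_mem : elB₁ ∈ GammaPrime := elC_mul_elB ▸ mul_mem elC_mem elB_mem

theorem GammaPrime_eq_closure : GammaPrime = Subgroup.closure {elB, elB₁} := by
  apply le_antisymm
  · rw [GammaPrime, Subgroup.closure_le]
    have hB : elB ∈ Subgroup.closure {elB, elB₁} := Subgroup.subset_closure (Or.inl rfl)
    have hB₁ : elB₁ ∈ Subgroup.closure {elB, elB₁} := Subgroup.subset_closure (Or.inr rfl)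
    rintro g (rfl | rfl)
    · exact hB
    · have := mul_mem hB₁ (inv_mem hB)
      change elC ∈ Subgroup.closure {elB, elB₁}
      rw [← elC_mul_elB] at this ⊢
      rwa [mul_inv_cancel_right] at this
  · rw [Subgroup.closure_le]
    rintro g (rfl | rfl)
    · exact elB_mem
    · exact elB₁_mem

theorem GammaPrime_le_Gamma6 : GammaPrime ≤ Gamma6 := by
  have hS : genS ∈ Gamma6 := Subgroup.subset_closure (Or.inl rfl)
  have hT : genT ∈ Gamma6 := Subgroup.subset_closure (Or.inr rfl)
  have hB : elB ∈ Gamma6 := mul_mem hT hS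
  have hV : elV ^ 3 ∈ Gamma6 := pow_mem (mul_mem hT (inv_mem hS)) 3
  rw [GammaPrime, Subgroup.closure_le]
  rintro g (rfl | rfl)
  · exact hB
  · exact mul_mem (mul_mem hV hB) (inv_mem hV)

/-! ### The symmetric-square model of `Γ'` -/

/-- The coordinates in which `Γ'` acts on `ℂ³` as on the symmetric matrices `(x₀, x₁; x₁, x₂)`. -/
noncomputable def symCoord : (Fin 3 → ℂ) ≃ₗ[ℂ] (Fin 3 → ℂ) where
  -- The basis is adapted to the two parabolic generators: `x₀` multiplies the fixed vector `e₃` of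
  -- `B`, `x₂` multiplies `V³e₃`, which `V³BV⁻³` fixes, and `x₁` multiplies a vector orthogonal to
  -- both.
  toFun x := ![-4 * x 2, -2 * (√2 : ℝ) * x 1 + (√2 : ℝ) * (2 * zeta - 2) * x 2,
    x 0 + 2 * zeta * x 1 + (4 * zeta - 1) * x 2]
  invFun v := ![v 2 + (√2 : ℝ) / 2 * zeta * v 1 + (-3 / 4 + zeta) * v 0,
    -(√2 : ℝ) / 4 * v 1 + (1 - zeta) / 4 * v 0, -1 / 4 * v 0]
  map_add' x y := by
    ext i; fin_cases i <;> simp <;> ring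
  map_smul' t x := by
    ext i; fin_cases i <;> simp <;> ring
  left_inv x := by
    have hz := zeta_sq
    have h2 := sqrt_two_sq
    ext i; fin_cases i <;> simp <;> grind
  right_inv x := by
    have hz := zeta_sq
    have h2 := sqrt_two_sq
    ext i; fin_cases i <;> simp <;> grind

/-- The action of the matrix `(p, q; r, s)` on symmetric matrices. -/
def symAct {R : Type*} [CommRing R] (p q r s : R) (x : Fin 3 → R) : Fin 3 → R :=
  ![p ^ 2 * x 0 + 2 * p * q * x 1 + q ^ 2 * x 2,
    p * r * x 0 + (p * s + q * r) * x 1 + q * s * x 2,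
    r ^ 2 * x 0 + 2 * r * s * x 1 + s ^ 2 * x 2]

theorem symAct_symAct {R : Type*} [CommRing R] (p q r s p' q' r' s' : R) (x : Fin 3 → R) :
    symAct p q r s (symAct p' q' r' s' x) =
      symAct (p * p' + q * r') (p * q' + q * s') (r * p' + s * r') (r * q' + s * s') x := by
  ext i; fin_cases i <;> simp [symAct] <;> ring

theorem symAct_one {R : Type*} [CommRing R] (x : Fin 3 → R) : symAct 1 0 0 1 x = x := by
  ext i; fin_cases i <;> simp [symAct]

theorem elB_smul (x : Fin 3 → ℂ) : elB • symCoord x = symCoord (symAct 1 2 0 1 x) := by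
  have hz := zeta_sq
  have h2 := sqrt_two_sq
  change (elB : Matrix (Fin 3) (Fin 3) ℂ).mulVec (symCoord x) = _
  rw [coe_elB]
  ext i
  fin_cases i <;> simp [symCoord, symAct, Matrix.mulVec, dotProduct, Fin.sum_univ_three] <;> grind

theorem elC_smul (x : Fin 3 → ℂ) : elC • symCoord x = symCoord (symAct 1 0 (-2) 1 x) := by
  have hz := zeta_sq
  have h2 := sqrt_two_sq
  change (elC : Matrix (Fin 3) (Fin 3) ℂ).mulVec (symCoord x) = _
  rw [coe_elC]
  ext i
  fin_cases i <;> simp [symCoord, symAct, Matrix.mulVec, dotProduct, Fin.sum_univ_three] <;> grind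

/-- On real vectors the right-hand side is real, and on the diagonal it is `-8` times the
determinant of the symmetric matrix. So real null vectors are exactly the real singular matrices. -/
theorem herm_symCoord (x y : Fin 3 → ℂ) :
    herm (symCoord x) (symCoord y) =
      -4 * (star (x 0) * y 2 + star (x 2) * y 0 - 2 * (star (x 1) * y 1)) := by
  have hz := zeta_sq
  have h2 := sqrt_two_sq
  have h3 : (starRingEnd ℂ) zeta = 1 - zeta := star_zeta
  simp [herm, symCoord, h3]
  grind

/-- Integrality of `p, q, r, s` is the form in which discreteness of `Γ'` enters the limit set
argument. -/
theorem exists_symAct {g : SpecialLinearGroup (Fin 3) ℂ} (hg : g ∈ GammaPrime) :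
    ∃ p q r s : ℤ, p * s - q * r = 1 ∧
      ∀ x, g • symCoord x = symCoord (symAct (p : ℂ) q r s x) := by
  induction hg using Subgroup.closure_induction with
  | mem g hg =>
    obtain rfl | rfl := hg
    · exact ⟨1, 2, 0, 1, by norm_num, fun x => by simpa using elB_smul x⟩
    · exact ⟨1, 0, -2, 1, by norm_num, fun x => by
        simpa [elC] using elC_smul x⟩
  | one => exact ⟨1, 0, 0, 1, by norm_num, fun x => by simp [symAct_one]⟩
  | mul g h _ _ hg hh =>
    obtain ⟨p, q, r, s, hd, hg⟩ := hg
    obtain ⟨p', q', r', s', hd', hh⟩ := hh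
    refine ⟨p * p' + q * r', p * q' + q * s', r * p' + s * r', r * q' + s * s', ?_, fun x => ?_⟩
    · linear_combination hd * (p' * s' - q' * r') + hd'
    · rw [mul_smul, hh, hg, symAct_symAct]
      push_cast
      rfl
  | inv g _ hg =>
    obtain ⟨p, q, r, s, hd, hg⟩ := hg
    refine ⟨s, -q, -r, p, by linear_combination hd, fun x => ?_⟩
    rw [inv_smul_eq_iff, hg, symAct_symAct]
    have hd' : (p * s - q * r : ℂ) = 1 := by exact_mod_cast hd
    conv_lhs => rw [← symAct_one x]
    push_cast
    congr 2
    · linear_combination -hd'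
    · ring
    · ring
    · linear_combination -hd'

/-! ### Coordinates and topology on the projective plane -/

/-- The point of the projective plane with coordinates `x`. -/
noncomputable def symPt (x : Fin 3 → ℂ) (hx : x ≠ 0) : CP2 :=
  Projectivization.mk ℂ (symCoord x) (symCoord.map_ne_zero_iff.2 hx)

theorem mk_eq_symPt (v : Fin 3 → ℂ) (hv : v ≠ 0) :
    Projectivization.mk ℂ v hv = symPt (symCoord.symm v) (symCoord.symm.map_ne_zero_iff.2 hv) := by
  simp [symPt]

theorem exists_eq_symPt (p : CP2) : ∃ x hx, p = symPt x hx := by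
  induction p using Projectivization.ind with
  | h v hv => exact ⟨_, _, mk_eq_symPt v hv⟩

theorem symPt_eq_symPt_iff {x y : Fin 3 → ℂ} (hx : x ≠ 0) (hy : y ≠ 0) :
    symPt x hx = symPt y hy ↔ ∃ t : ℂ, t • y = x := by
  simp [symPt, Projectivization.mk_eq_mk_iff', ← map_smul]

theorem smul_symPt {g : SpecialLinearGroup (Fin 3) ℂ} {x y : Fin 3 → ℂ} (hx : x ≠ 0) (hy : y ≠ 0)
    (h : g • symCoord x = symCoord y) : g • symPt x hx = symPt y hy := by
  simp only [symPt, Projectivization.smul_mk, h]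

theorem ne_zero_of_smul_symCoord {g : SpecialLinearGroup (Fin 3) ℂ} {x y : Fin 3 → ℂ} (hx : x ≠ 0)
    (h : g • symCoord x = symCoord y) : y ≠ 0 := by
  rintro rfl
  rw [map_zero, smul_eq_zero_iff_eq] at h
  exact hx (symCoord.map_eq_zero_iff.1 h)

theorem continuous_mk' :
    Continuous (Projectivization.mk' ℂ : {v : Fin 3 → ℂ // v ≠ 0} → CP2) :=
  continuous_coinduced_rng

theorem continuous_symCoord : Continuous symCoord :=
  symCoord.toLinearMap.continuous_of_finiteDimensional

theorem continuous_symCoord_symm : Continuous symCoord.symm :=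
  symCoord.symm.toLinearMap.continuous_of_finiteDimensional

theorem tendsto_symPt {α : Type*} {l : Filter α} {x : α → Fin 3 → ℂ} {y : Fin 3 → ℂ}
    (hx : ∀ n, x n ≠ 0) (hy : y ≠ 0) (h : Tendsto x l (𝓝 y)) :
    Tendsto (fun n => symPt (x n) (hx n)) l (𝓝 (symPt y hy)) := by
  have h1 : Tendsto (fun n => (⟨symCoord (x n), symCoord.map_ne_zero_iff.2 (hx n)⟩ :
      {v : Fin 3 → ℂ // v ≠ 0})) l (𝓝 ⟨symCoord y, symCoord.map_ne_zero_iff.2 hy⟩) :=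
    tendsto_subtype_rng.2 ((continuous_symCoord.tendsto y).comp h)
  exact (continuous_mk'.tendsto _).comp h1

/-- The preimage of a point is a punctured complex line, closed in `ℂ³ \ {0}`. This gives closedness
of finite sets and of derived sets. -/
instance : T1Space CP2 where
  t1 p := by
    induction p using Projectivization.ind with
    | h w hw =>
      rw [isClosed_coinduced]
      have : Projectivization.mk' ℂ ⁻¹' {Projectivization.mk ℂ w hw} =
          Subtype.val ⁻¹' (Submodule.span ℂ {w} : Set (Fin 3 → ℂ)) := by
        ext ⟨v, hv⟩
        rw [Set.mem_preimage, Set.mem_singleton_iff, Projectivization.mk'_eq_mk,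
          Projectivization.mk_eq_mk_iff']
        simp [Submodule.mem_span_singleton]
      rw [this]
      exact (Submodule.closed_of_finiteDimensional _).preimage continuous_subtype_val

theorem continuous_smul_CP2 (g : SpecialLinearGroup (Fin 3) ℂ) :
    Continuous fun p : CP2 => g • p := by
  refine continuous_coinduced_dom.2 ?_
  have hg : Continuous fun v : Fin 3 → ℂ => g • v := by
    change Continuous fun v : Fin 3 → ℂ => g.1.mulVec v
    exact Continuous.matrix_mulVec continuous_const continuous_id
  have : (fun p : CP2 => g • p) ∘ Projectivization.mk' ℂ =
      Projectivization.mk' ℂ ∘ fun v : {v : Fin 3 → ℂ // v ≠ 0} =>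
        (⟨g • v.1, (smul_ne_zero_iff_ne g).2 v.2⟩ : {v : Fin 3 → ℂ // v ≠ 0}) := by
    funext v
    simp [Projectivization.mk'_eq_mk, Projectivization.smul_mk]
  rw [this]
  exact continuous_mk'.comp ((hg.comp continuous_subtype_val).subtype_mk _)

/-! ### The invariant defect and the Veronese circle -/

/-- A nonnegative function, invariant under real changes of basis of determinant one, whose zeros
are the multiples of the real symmetric matrices of rank one. -/
noncomputable def defect (x : Fin 3 → ℂ) : ℝ :=
  ‖x 0 * x 2 - x 1 ^ 2‖ + ‖star (x 0) * x 2 + star (x 2) * x 0 - 2 * (star (x 1) * x 1)‖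

theorem defect_nonneg (x : Fin 3 → ℂ) : 0 ≤ defect x := by
  unfold defect; positivity

theorem defect_eq_zero_iff (x : Fin 3 → ℂ) :
    defect x = 0 ↔ x 0 * x 2 - x 1 ^ 2 = 0 ∧
      star (x 0) * x 2 + star (x 2) * x 0 - 2 * (star (x 1) * x 1) = 0 := by
  rw [defect, add_eq_zero_iff_of_nonneg (norm_nonneg _) (norm_nonneg _), norm_eq_zero,
    norm_eq_zero]

theorem continuous_defect : Continuous defect := by
  unfold defect
  fun_prop

theorem defect_smul (t : ℂ) (x : Fin 3 → ℂ) : defect (t • x) = ‖t‖ ^ 2 * defect x := by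
  simp only [defect, Pi.smul_apply, smul_eq_mul, star_mul']
  rw [show t * x 0 * (t * x 2) - (t * x 1) ^ 2 = t ^ 2 * (x 0 * x 2 - x 1 ^ 2) by ring,
    show star t * star (x 0) * (t * x 2) + star t * star (x 2) * (t * x 0) -
      2 * (star t * star (x 1) * (t * x 1)) =
      star t * t * (star (x 0) * x 2 + star (x 2) * x 0 - 2 * (star (x 1) * x 1)) by ring]
  simp only [norm_mul, norm_pow, norm_star]
  ring

/-- Both the determinant and its Hermitian polarization are multiplied by `(ps - qr)²`. -/
theorem defect_symAct {p q r s : ℤ} (h : p * s - q * r = 1) (x : Fin 3 → ℂ) :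
    defect (symAct (p : ℂ) q r s x) = defect x := by
  have h' : (p * s - q * r : ℂ) = 1 := by exact_mod_cast h
  simp only [defect, symAct, Matrix.cons_val_zero, Matrix.cons_val_one, Matrix.cons_val,
    Complex.star_def, map_add, map_mul, map_pow, map_intCast, map_ofNat]
  congr 2
  · linear_combination (x 0 * x 2 - x 1 ^ 2) * (p * s - q * r + 1) * h'
  · linear_combination ((starRingEnd ℂ) (x 0) * x 2 + (starRingEnd ℂ) (x 2) * x 0 -
      2 * ((starRingEnd ℂ) (x 1) * x 1)) * (p * s - q * r + 1) * h'

/-- The defect of a point, normalized to be homogeneous of degree zero. -/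
noncomputable def ptDefect (p : CP2) : ℝ :=
  defect (symCoord.symm p.rep) / ‖symCoord.symm p.rep‖ ^ 2

theorem ptDefect_symPt (x : Fin 3 → ℂ) (hx : x ≠ 0) : ptDefect (symPt x hx) = defect x / ‖x‖ ^ 2 := by
  obtain ⟨a, ha⟩ := Projectivization.exists_smul_eq_mk_rep ℂ (symCoord x)
    (symCoord.map_ne_zero_iff.2 hx)
  have h0 : ‖(a : ℂ)‖ ≠ 0 := norm_ne_zero_iff.2 a.ne_zero
  rw [ptDefect, symPt, ← ha, Units.smul_def, map_smul, LinearEquiv.symm_apply_apply, defect_smul,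
    norm_smul, mul_pow]
  exact mul_div_mul_left _ _ (pow_ne_zero 2 h0)

theorem continuous_ptDefect : Continuous ptDefect := by
  refine continuous_coinduced_dom.2 ?_
  have : ptDefect ∘ Projectivization.mk' ℂ = fun v : {v : Fin 3 → ℂ // v ≠ 0} =>
      defect (symCoord.symm v) / ‖symCoord.symm v‖ ^ 2 := by
    funext v
    rw [Function.comp_apply, Projectivization.mk'_eq_mk, mk_eq_symPt, ptDefect_symPt]
  rw [this]
  have h1 : Continuous fun v : {v : Fin 3 → ℂ // v ≠ 0} => symCoord.symm v :=
    continuous_symCoord_symm.comp continuous_subtype_val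
  refine (continuous_defect.comp h1).div (h1.norm.pow 2) fun v => ?_
  exact pow_ne_zero 2 (norm_ne_zero_iff.2 (symCoord.symm.map_ne_zero_iff.2 v.2))

/-- The `ℝ`-circle of the real symmetric matrices of rank one. -/
noncomputable def veroneseCircle : Set CP2 := {p | ptDefect p = 0}

theorem symPt_mem_veroneseCircle_iff (x : Fin 3 → ℂ) (hx : x ≠ 0) :
    symPt x hx ∈ veroneseCircle ↔ defect x = 0 := by
  have : ‖x‖ ^ 2 ≠ 0 := pow_ne_zero 2 (norm_ne_zero_iff.2 hx)
  rw [veroneseCircle, Set.mem_ofPred_eq, ptDefect_symPt, div_eq_zero_iff, or_iff_left this]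

theorem smul_mem_veroneseCircle_iff {g : SpecialLinearGroup (Fin 3) ℂ} (hg : g ∈ GammaPrime)
    (p : CP2) : g • p ∈ veroneseCircle ↔ p ∈ veroneseCircle := by
  obtain ⟨x, hx, rfl⟩ := exists_eq_symPt p
  obtain ⟨p, q, r, s, hd, h⟩ := exists_symAct hg
  rw [smul_symPt hx (ne_zero_of_smul_symCoord hx (h x)) (h x), symPt_mem_veroneseCircle_iff,
    symPt_mem_veroneseCircle_iff, defect_symAct hd]

theorem image_smul_veroneseCircle {g : SpecialLinearGroup (Fin 3) ℂ} (hg : g ∈ GammaPrime) :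
    (fun p : CP2 => g • p) '' veroneseCircle = veroneseCircle := by
  ext p
  constructor
  · rintro ⟨q, hq, rfl⟩
    exact (smul_mem_veroneseCircle_iff hg q).2 hq
  · intro hp
    exact ⟨g⁻¹ • p, (smul_mem_veroneseCircle_iff (inv_mem hg) p).2 hp, smul_inv_smul g p⟩

theorem vec_one_ne_zero : (![1, 0, 0] : Fin 3 → ℂ) ≠ 0 := fun h => by simpa using congrFun h 0

theorem veronese_ne_zero (y : ℝ) : (![(y : ℂ) ^ 2, y, 1] : Fin 3 → ℂ) ≠ 0 :=
  fun h => by simpa using congrFun h 2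

theorem pB_eq_symPt : pB = symPt ![1, 0, 0] vec_one_ne_zero := by
  rw [pB, symPt]
  congr 1
  ext i
  fin_cases i <;> simp [symCoord]

/-- If `x₂ ≠ 0`, put `z = x₁ / x₂`. Vanishing of the determinant gives `x₀ = z² x₂`, and the
Hermitian condition then reads `|x₂|² (conj z - z)² = 0`, so `z` is real. -/
theorem eq_veronese_of_defect_eq_zero {x : Fin 3 → ℂ} (h : defect x = 0) :
    (∃ t : ℂ, x = t • ![1, 0, 0]) ∨ ∃ (t : ℂ) (y : ℝ), x = t • ![(y : ℂ) ^ 2, (y : ℂ), 1] := by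
  rw [defect_eq_zero_iff] at h
  obtain ⟨h1, h2⟩ := h
  by_cases hc : x 2 = 0
  · left
    have hb : x 1 = 0 := by simpa [hc] using h1
    exact ⟨x 0, by ext i; fin_cases i <;> simp [hb, hc]⟩
  · right
    set z := x 1 / x 2 with hz
    have hb : x 1 = z * x 2 := by rw [hz]; field_simp
    have ha : x 0 = z ^ 2 * x 2 := by
      apply mul_right_cancel₀ hc
      rw [hb] at h1
      linear_combination h1
    have hs : star (x 2) ≠ 0 := star_ne_zero.2 hc
    have hzz : (starRingEnd ℂ) z = z := by
      rw [ha, hb, star_mul', star_mul', star_pow] at h2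
      have : star (x 2) * x 2 * (star z - z) ^ 2 = 0 := by linear_combination h2
      simpa [hc, sub_eq_zero] using this
    obtain ⟨y, hy⟩ := Complex.conj_eq_iff_real.1 hzz
    refine ⟨x 2, y, ?_⟩
    ext i
    fin_cases i <;> simp [ha, hb, hy, mul_comm]

theorem mem_veroneseCircle_iff (p : CP2) : p ∈ veroneseCircle ↔
    p = symPt ![1, 0, 0] vec_one_ne_zero ∨ ∃ y : ℝ, p = symPt _ (veronese_ne_zero y) := by
  constructor
  · obtain ⟨x, hx, rfl⟩ := exists_eq_symPt p
    rw [symPt_mem_veroneseCircle_iff]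
    intro h
    obtain ⟨t, h⟩ | ⟨t, y, h⟩ := eq_veronese_of_defect_eq_zero h
    · exact Or.inl ((symPt_eq_symPt_iff _ _).2 ⟨t, h.symm⟩)
    · exact Or.inr ⟨y, (symPt_eq_symPt_iff _ _).2 ⟨t, h.symm⟩⟩
  · rintro (rfl | ⟨y, rfl⟩)
    · rw [symPt_mem_veroneseCircle_iff, defect_eq_zero_iff]
      simp
    · rw [symPt_mem_veroneseCircle_iff, defect_eq_zero_iff]
      simp
      ring

/-! ### The circle as an `ℝ`-circle, and its uniqueness -/

/-- The vectors whose coordinates are real. -/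
noncomputable def realCoord : (Fin 3 → ℝ) →ₗ[ℝ] (Fin 3 → ℂ) where
  toFun x := symCoord fun i => (x i : ℂ)
  map_add' x y := by
    rw [← map_add]
    congr 1
    ext i
    simp
  map_smul' t x := by
    ext i
    have : (fun i => (((t • x) i : ℝ) : ℂ)) = (t : ℂ) • fun i => (x i : ℂ) := by
      ext i
      simp
    rw [this, map_smul]
    simp

theorem realCoord_apply (x : Fin 3 → ℝ) : realCoord x = symCoord fun i => (x i : ℂ) := rfl

theorem isTotallyReal_range_realCoord : IsTotallyReal (LinearMap.range realCoord) := by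
  refine ⟨?_, ?_, ?_⟩
  · rw [LinearMap.finrank_range_of_inj]
    · simp
    · intro x y h
      rw [realCoord_apply, realCoord_apply] at h
      ext i
      simpa using congrFun (symCoord.injective h) i
  · rintro _ ⟨x, rfl⟩ ⟨y, h⟩
    rw [realCoord_apply, realCoord_apply, ← map_smul] at h
    have : x = 0 := by
      ext i
      have := congrArg Complex.im (congrFun (symCoord.injective h) i)
      simpa using this.symm
    rw [this, map_zero]
  · rintro _ ⟨x, rfl⟩ _ ⟨y, rfl⟩
    rw [realCoord_apply, realCoord_apply, herm_symCoord]
    simp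

theorem defect_eq_zero_of_real {x : Fin 3 → ℝ} {v : Fin 3 → ℂ} (hv : v = realCoord x)
    (h : herm v v = 0) : defect (fun i => (x i : ℂ)) = 0 := by
  rw [hv, realCoord_apply, herm_symCoord] at h
  simp only [Complex.star_def, Complex.conj_ofReal] at h
  rw [defect_eq_zero_iff]
  simp only [Complex.star_def, Complex.conj_ofReal]
  constructor
  · linear_combination -1 / 8 * h
  · linear_combination -1 / 4 * h

theorem herm_smul_smul (s t : ℂ) (v w : Fin 3 → ℂ) :
    herm (s • v) (t • w) = star s * t * herm v w := by
  simp only [herm, Pi.smul_apply, smul_eq_mul, star_mul']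
  ring

/-- A common complex scalar `t` does not affect the projectivization. Existence uses `t = 1`;
uniqueness needs an arbitrary `t`, since `L` is only determined up to such a scalar. -/
theorem isRCircle_eq_veroneseCircle {t : ℂ} (ht : t ≠ 0) {L : Submodule ℝ (Fin 3 → ℂ)}
    (hL : ∀ v, v ∈ L ↔ ∃ x, v = t • realCoord x) :
    {p | p ∈ bdHC2 ∧ ∃ (v : Fin 3 → ℂ) (hv : v ≠ 0), v ∈ L ∧ p = Projectivization.mk ℂ v hv} =
      veroneseCircle := by
  ext p
  constructor
  · rintro ⟨⟨w, hw, hww, rfl⟩, v, hv, hvL, h⟩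
    obtain ⟨x, rfl⟩ := (hL v).1 hvL
    rw [Projectivization.mk_eq_mk_iff'] at h
    obtain ⟨a, rfl⟩ := h
    have ha : a ≠ 0 := by rintro rfl; simp at hw
    rw [smul_smul, herm_smul_smul] at hww
    have h0 : herm (realCoord x) (realCoord x) = 0 := by simpa [ha, ht] using hww
    have hx : (fun i => (x i : ℂ)) ≠ 0 := by
      rintro h
      rw [realCoord_apply, h] at hv
      simp at hv
    have : Projectivization.mk ℂ (a • t • realCoord x) hw = symPt _ hx := by
      rw [symPt, Projectivization.mk_eq_mk_iff']
      exact ⟨a * t, by rw [mul_smul, realCoord_apply]⟩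
    rw [this, symPt_mem_veroneseCircle_iff]
    exact defect_eq_zero_of_real rfl h0
  · intro hp
    have key : ∀ x : Fin 3 → ℝ, ∀ hx : (fun i => (x i : ℂ)) ≠ 0, x 0 * x 2 = x 1 ^ 2 →
        symPt _ hx ∈ {p | p ∈ bdHC2 ∧ ∃ (v : Fin 3 → ℂ) (hv : v ≠ 0), v ∈ L ∧
          p = Projectivization.mk ℂ v hv} := by
      intro x hx h
      have h' : (x 0 : ℂ) * x 2 = (x 1 : ℂ) ^ 2 := by exact_mod_cast h
      refine ⟨⟨_, symCoord.map_ne_zero_iff.2 hx, ?_, rfl⟩, t • realCoord x,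
        smul_ne_zero ht (symCoord.map_ne_zero_iff.2 hx), (hL _).2 ⟨x, rfl⟩, ?_⟩
      · rw [herm_symCoord]
        simp only [Complex.star_def, Complex.conj_ofReal]
        linear_combination -8 * h'
      · rw [symPt, Projectivization.mk_eq_mk_iff']
        exact ⟨t⁻¹, by rw [inv_smul_smul₀ ht, realCoord_apply]⟩
    obtain rfl | ⟨y, rfl⟩ := (mem_veroneseCircle_iff p).1 hp
    · have e : (fun i => ((![1, 0, 0] : Fin 3 → ℝ) i : ℂ)) = ![1, 0, 0] := by
        ext i; fin_cases i <;> simp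
      have := key ![1, 0, 0] (e ▸ vec_one_ne_zero) (by simp)
      simpa only [e] using this
    · have e : (fun i => ((![y ^ 2, y, 1] : Fin 3 → ℝ) i : ℂ)) = ![(y : ℂ) ^ 2, (y : ℂ), 1] := by
        ext i; fin_cases i <;> simp
      have := key ![y ^ 2, y, 1] (e ▸ veronese_ne_zero y) (by simp)
      simpa only [e] using this

theorem isRCircle_veroneseCircle : IsRCircle veroneseCircle := by
  refine ⟨_, isTotallyReal_range_realCoord, (isRCircle_eq_veroneseCircle one_ne_zero ?_).symm⟩
  intro v
  simp [LinearMap.mem_range, eq_comm]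

theorem herm_realCoord_symCoord (x : Fin 3 → ℝ) (y : Fin 3 → ℂ) :
    herm (realCoord x) (symCoord y) = -4 * (x 0 * y 2 + x 2 * y 0 - 2 * (x 1 * y 1)) := by
  rw [realCoord_apply, herm_symCoord]
  simp only [Complex.star_def, Complex.conj_ofReal]

/-- A representative of the second point in `L` has the form `a • realCoord y`. Its product with `t
• realCoord x` is `conj t * a` times a nonzero real number, so `conj t * a` is real and `t` is a
real multiple of `a`. -/
theorem smul_realCoord_mem {L : Submodule ℝ (Fin 3 → ℂ)} (hL : IsTotallyReal L) {t : ℂ}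
    (ht : t ≠ 0) {x y : Fin 3 → ℝ} (hxL : t • realCoord x ∈ L)
    (hxy : x 0 * y 2 + x 2 * y 0 - 2 * (x 1 * y 1) ≠ 0) {z : Fin 3 → ℂ}
    (hzy : ∀ i, z i = y i) (hz : z ≠ 0)
    (hy : ∃ (v : Fin 3 → ℂ) (hv : v ≠ 0), v ∈ L ∧ symPt z hz = Projectivization.mk ℂ v hv) :
    t • realCoord y ∈ L := by
  obtain rfl : z = fun i => (y i : ℂ) := funext hzy
  obtain ⟨v, hv, hvL, h⟩ := hy
  rw [symPt, Eq.comm, Projectivization.mk_eq_mk_iff', ← realCoord_apply] at h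
  obtain ⟨a, rfl⟩ := h
  have ha : a ≠ 0 := by rintro rfl; simp at hv
  have him := hL.2.2 _ hxL _ hvL
  rw [herm_smul_smul, realCoord_apply y, herm_realCoord_symCoord] at him
  have e : (-4 * ((x 0 : ℂ) * y 2 + x 2 * y 0 - 2 * (x 1 * y 1))) =
      ((-4 * (x 0 * y 2 + x 2 * y 0 - 2 * (x 1 * y 1)) : ℝ) : ℂ) := by push_cast; ring
  rw [e, Complex.im_mul_ofReal] at him
  have him' : (star t * a).im = 0 := by
    rcases mul_eq_zero.1 him with h | h
    · exact h
    · exact absurd (by simpa using h) hxy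
  obtain ⟨r, hr⟩ : ∃ r : ℝ, star t * a = r := ⟨_, (Complex.ext rfl (by simpa using him'))⟩
  have hst : star t ≠ 0 := star_ne_zero.2 ht
  have hr0 : (r : ℂ) ≠ 0 := hr ▸ mul_ne_zero hst ha
  have hn : star t * t = ((Complex.normSq t : ℝ) : ℂ) := Complex.normSq_eq_conj_mul_self.symm
  have hta : t = ((Complex.normSq t / r : ℝ) : ℂ) * a := by
    push_cast
    apply mul_left_cancel₀ hst
    rw [hn, ← hr]
    field_simp
  have := L.smul_mem (Complex.normSq t / r) hvL
  rwa [← Complex.coe_smul, smul_smul, ← hta] at this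

/-- With `B₁ = CB`, the column `(1, 0)` goes to `(1, -2)`, whose symmetric square is `(1, -2, 4)`.
For the inverse, it goes to `(-3, 2)`, giving `(9, -6, 4)`. -/
theorem elB₁_smul_pB : elB₁ • pB = symPt ![1, -2, 4] (fun h => by simpa using congrFun h 0) := by
  rw [pB_eq_symPt]
  apply smul_symPt
  rw [← elC_mul_elB, mul_smul, elB_smul, elC_smul]
  congr 1
  ext i
  fin_cases i <;> simp [symAct]; norm_num

theorem elB_inv_smul (x : Fin 3 → ℂ) : elB⁻¹ • symCoord x = symCoord (symAct 1 (-2) 0 1 x) := by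
  rw [inv_smul_eq_iff, elB_smul, symAct_symAct]
  norm_num [symAct_one]

theorem elC_inv_smul (x : Fin 3 → ℂ) : elC⁻¹ • symCoord x = symCoord (symAct 1 0 2 1 x) := by
  rw [inv_smul_eq_iff, elC_smul, symAct_symAct]
  norm_num [symAct_one]

theorem elB₁_inv_smul_pB :
    elB₁⁻¹ • pB = symPt ![9, -6, 4] (fun h => by simpa using congrFun h 0) := by
  rw [pB_eq_symPt]
  apply smul_symPt
  rw [← elC_mul_elB, _root_.mul_inv_rev, mul_smul, elC_inv_smul, elB_inv_smul]
  congr 1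
  ext i
  fin_cases i <;> simp [symAct] <;> norm_num

theorem pB_mem_veroneseCircle : pB ∈ veroneseCircle :=
  (mem_veroneseCircle_iff _).2 (Or.inl pB_eq_symPt)

theorem IsRCircle.eq_veroneseCircle {R : Set CP2} (hR : IsRCircle R) (h₀ : pB ∈ R)
    (h₁ : elB₁ • pB ∈ R) (h₂ : elB₁⁻¹ • pB ∈ R) : R = veroneseCircle := by
  obtain ⟨L, hL, rfl⟩ := hR
  rw [pB_eq_symPt] at h₀
  rw [elB₁_smul_pB] at h₁
  rw [elB₁_inv_smul_pB] at h₂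
  have hcast : ∀ a b c : ℝ, ∀ i, (![(a : ℂ), (b : ℂ), (c : ℂ)] : Fin 3 → ℂ) i =
      ((![a, b, c] : Fin 3 → ℝ) i : ℂ) := by
    intro a b c i
    fin_cases i <;> rfl
  obtain ⟨t, ht, h0⟩ : ∃ t : ℂ, t ≠ 0 ∧ t • realCoord ![1, 0, 0] ∈ L := by
    obtain ⟨-, v, hv, hvL, h⟩ := h₀
    rw [symPt, Eq.comm, Projectivization.mk_eq_mk_iff'] at h
    obtain ⟨t, rfl⟩ := h
    refine ⟨t, by rintro rfl; simp at hv, ?_⟩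
    rw [realCoord_apply]
    convert hvL using 3
    ext i
    fin_cases i <;> simp
  have h1 : t • realCoord ![1, -2, 4] ∈ L :=
    smul_realCoord_mem hL ht h0 (by simp) (fun i => by simpa using hcast 1 (-2) 4 i) _ h₁.2
  have h2 : t • realCoord ![9, -6, 4] ∈ L :=
    smul_realCoord_mem hL ht h0 (by simp) (fun i => by simpa using hcast 9 (-6) 4 i) _ h₂.2
  apply isRCircle_eq_veroneseCircle ht
  intro v
  constructor
  · intro hv
    obtain ⟨y, rfl⟩ : ∃ y, v = t • symCoord y :=
      ⟨symCoord.symm (t⁻¹ • v), by simp [smul_inv_smul₀ ht]⟩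
    -- Pairing with a real vector of `t⁻¹L` annihilates the imaginary part of `y`. Three independent
    -- such vectors and nondegeneracy force `y` to be real.
    have key : ∀ x : Fin 3 → ℝ, t • realCoord x ∈ L →
        x 0 * (y 2).im + x 2 * (y 0).im - 2 * (x 1 * (y 1).im) = 0 := by
      intro x hx
      have him := hL.2.2 _ hx _ hv
      have hn : star t * t = ((Complex.normSq t : ℝ) : ℂ) := Complex.normSq_eq_conj_mul_self.symm
      rw [herm_smul_smul, hn, Complex.im_ofReal_mul, herm_realCoord_symCoord] at him
      have := (mul_eq_zero.1 him).resolve_left (by simpa using ht)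
      simp at this
      linarith
    have k0 := key _ h0
    have k1 := key _ h1
    have k2 := key _ h2
    simp at k0 k1 k2
    refine ⟨fun i => (y i).re, ?_⟩
    rw [realCoord_apply]
    congr 2
    ext i
    have him : (y i).im = 0 := by fin_cases i <;> simp <;> linarith
    exact (Complex.ext rfl (by simpa using him))
  · rintro ⟨x, rfl⟩
    have e : x = (x 0 - (x 2 / 4 + (2 * x 1 + x 2) / 8) + 9 * (2 * x 1 + x 2) / 8) • ![1, 0, 0] +
        (x 2 / 4 + (2 * x 1 + x 2) / 8) • ![1, -2, 4] +
        (-(2 * x 1 + x 2) / 8) • ![9, -6, 4] := by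
      ext i
      fin_cases i <;> simp <;> ring
    rw [e, map_add, map_add, map_smul, map_smul, map_smul, smul_add, smul_add,
      smul_comm t, smul_comm t, smul_comm t]
    exact L.add_mem (L.add_mem (L.smul_mem _ h0) (L.smul_mem _ h1)) (L.smul_mem _ h2)

/-! ### Accumulation points lie on the circle -/

theorem mem_Icc_ceil_of_sq_le {n : ℤ} {K : ℝ} (h : (n : ℝ) ^ 2 ≤ K) : n ∈ Set.Icc (-⌈K⌉) ⌈K⌉ := by
  have h1 : (|n| : ℝ) ≤ K := by
    have : (|n| : ℤ) ≤ n ^ 2 := by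
      rw [← sq_abs]
      exact Int.le_self_sq _
    have : ((|n| : ℤ) : ℝ) ≤ ((n ^ 2 : ℤ) : ℝ) := by exact_mod_cast this
    push_cast at this
    linarith
  have h2 : |n| ≤ ⌈K⌉ := by
    have := Int.ceil_mono h1
    rw [← Int.cast_abs, Int.ceil_intCast] at this
    exact this
  exact abs_le.1 h2

/-- The form is definite. Completing the square, `w (m²u + 2mnv + n²w) = m²(uw - v²) + (mv + nw)²`
bounds `m²`, and symmetrically for `n²`. -/
theorem finite_abs_quadratic_le {u v w : ℝ} (h : 0 < u * w - v ^ 2) (M : ℝ) :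
    {z : ℤ × ℤ | |z.1 ^ 2 * u + 2 * z.1 * z.2 * v + z.2 ^ 2 * w| ≤ M}.Finite := by
  refine ((Set.finite_Icc (-⌈|w| * M / (u * w - v ^ 2)⌉) ⌈|w| * M / (u * w - v ^ 2)⌉).prod
    (Set.finite_Icc (-⌈|u| * M / (u * w - v ^ 2)⌉) ⌈|u| * M / (u * w - v ^ 2)⌉)).subset ?_
  rintro ⟨m, n⟩ hz
  have hz' : |(m : ℝ) ^ 2 * u + 2 * m * n * v + n ^ 2 * w| ≤ M := hz
  refine ⟨mem_Icc_ceil_of_sq_le ?_, mem_Icc_ceil_of_sq_le ?_⟩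
  · rw [le_div_iff₀ h]
    have h1 := mul_le_mul_of_nonneg_left hz' (abs_nonneg w)
    rw [← abs_mul] at h1
    have h2 := le_abs_self (w * ((m : ℝ) ^ 2 * u + 2 * m * n * v + n ^ 2 * w))
    change (m : ℝ) ^ 2 * (u * w - v ^ 2) ≤ _
    nlinarith [sq_nonneg (m * v + n * w)]
  · rw [le_div_iff₀ h]
    have h1 := mul_le_mul_of_nonneg_left hz' (abs_nonneg u)
    rw [← abs_mul] at h1
    have h2 := le_abs_self (u * ((m : ℝ) ^ 2 * u + 2 * m * n * v + n ^ 2 * w))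
    change (n : ℝ) ^ 2 * (u * w - v ^ 2) ≤ _
    nlinarith [sq_nonneg (m * u + n * v)]

/-- The hypothesis says that the determinants of the real and imaginary parts of the symmetric
matrix have positive sum. One of the two real forms is thus definite, and the complex norm dominates
it. -/
theorem finite_norm_quadratic_le {a b c : ℂ}
    (h : 0 < (star a * c + star c * a - 2 * (star b * b)).re) (M : ℝ) :
    {z : ℤ × ℤ | ‖(z.1 : ℂ) ^ 2 * a + 2 * z.1 * z.2 * b + z.2 ^ 2 * c‖ ≤ M}.Finite := by
  have hsum : 0 < (a.re * c.re - b.re ^ 2) + (a.im * c.im - b.im ^ 2) := by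
    simp at h
    linarith
  rcases lt_or_ge 0 (a.re * c.re - b.re ^ 2) with h' | h'
  · refine (finite_abs_quadratic_le h' M).subset ?_
    rintro ⟨m, n⟩ hz
    refine le_trans (le_of_eq ?_) ((Complex.abs_re_le_norm _).trans hz)
    simp [pow_two]
  · refine (finite_abs_quadratic_le (u := a.im) (v := b.im) (w := c.im) (by linarith) M).subset ?_
    rintro ⟨m, n⟩ hz
    refine le_trans (le_of_eq ?_) ((Complex.abs_im_le_norm _).trans hz)
    simp [pow_two]

theorem exists_eq_symPt_of_mem_HC2 {p : CP2} (hp : p ∈ HC2) : ∃ x hx, p = symPt x hx ∧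
    0 < (star (x 0) * x 2 + star (x 2) * x 0 - 2 * (star (x 1) * x 1)).re := by
  obtain ⟨v, hv, h, rfl⟩ := hp
  refine ⟨_, _, mk_eq_symPt v hv, ?_⟩
  have e := herm_symCoord (symCoord.symm v) (symCoord.symm v)
  rw [LinearEquiv.apply_symm_apply] at e
  rw [e, show (-4 : ℂ) = ((-4 : ℝ) : ℂ) by norm_num, Complex.re_ofReal_mul] at h
  linarith

theorem notMem_veroneseCircle_of_mem_HC2 {p : CP2} (hp : p ∈ HC2) : p ∉ veroneseCircle := by
  obtain ⟨x, hx, rfl, h⟩ := exists_eq_symPt_of_mem_HC2 hp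
  rw [symPt_mem_veroneseCircle_iff, defect_eq_zero_iff]
  rintro ⟨-, h2⟩
  rw [h2] at h
  simp at h

/-- The defect of a lift is constant along the orbit, so normalized defect above `δ` bounds the norm
of the lift. Its two diagonal entries are the values at `(p, q)` and `(r, s)` of the form attached
to `x`, leaving finitely many integer matrices. -/
theorem finite_orbitOf_inter {x : CP2} (hx : x ∈ HC2) {δ : ℝ} (hδ : 0 < δ) :
    (orbitOf GammaPrime x ∩ {p | δ < ptDefect p}).Finite := by
  obtain ⟨x, hx₀, rfl, h⟩ := exists_eq_symPt_of_mem_HC2 hx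
  classical
  set K := {z : ℤ × ℤ | ‖(z.1 : ℂ) ^ 2 * x 0 + 2 * z.1 * z.2 * x 1 + z.2 ^ 2 * x 2‖ ≤
    1 + defect x / δ} with hK
  have hKfin : K.Finite := finite_norm_quadratic_le h _
  let f : (ℤ × ℤ) × (ℤ × ℤ) → CP2 := fun z =>
    if hz : symAct (z.1.1 : ℂ) z.1.2 z.2.1 z.2.2 x ≠ 0 then symPt _ hz else pB
  refine ((hKfin.prod hKfin).image f).subset ?_
  rintro _ ⟨⟨g, hg, rfl⟩, hgδ⟩
  obtain ⟨p, q, r, s, hd, h⟩ := exists_symAct hg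
  have hne := ne_zero_of_smul_symCoord hx₀ (h x)
  rw [smul_symPt hx₀ hne (h x), Set.mem_ofPred_eq, ptDefect_symPt, defect_symAct hd] at hgδ
  rw [smul_symPt hx₀ hne (h x)]
  set y := symAct (p : ℂ) q r s x with hy
  have hbound : ‖y‖ ≤ 1 + defect x / δ := by
    have hpos : 0 < ‖y‖ ^ 2 := pow_pos (norm_pos_iff.2 hne) 2
    rw [lt_div_iff₀ hpos] at hgδ
    have : ‖y‖ ^ 2 < defect x / δ := by
      rw [lt_div_iff₀ hδ]
      linarith
    nlinarith [sq_nonneg (‖y‖ - 1), norm_nonneg y]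
  refine ⟨((p, q), (r, s)), ⟨?_, ?_⟩, ?_⟩
  · exact (norm_le_pi_norm y 0).trans hbound
  · exact (norm_le_pi_norm y 2).trans hbound
  · simp only [f]
    rw [dif_pos hne]

theorem derivedSet_orbitOf_subset {x : CP2} (hx : x ∈ HC2) :
    derivedSet (orbitOf GammaPrime x) ⊆ veroneseCircle := by
  intro y hy
  by_contra hyc
  have hpos : 0 < ptDefect y := by
    refine lt_of_le_of_ne ?_ (Ne.symm hyc)
    exact div_nonneg (defect_nonneg _) (sq_nonneg _)
  have hfin := finite_orbitOf_inter hx (half_pos hpos)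
  rw [mem_derivedSet, accPt_iff_nhds] at hy
  have hU : {p | ptDefect y / 2 < ptDefect p} ∈ 𝓝 y :=
    (isOpen_lt continuous_const continuous_ptDefect).mem_nhds (half_lt_self hpos)
  have hV : ((orbitOf GammaPrime x ∩ {p | ptDefect y / 2 < ptDefect p}) \ {y})ᶜ ∈ 𝓝 y :=
    (hfin.subset Set.sdiff_subset).isClosed.isOpen_compl.mem_nhds (by simp)
  obtain ⟨z, ⟨⟨hz1, hz2⟩, hz3⟩, hz4⟩ := hy _ (inter_mem hU hV)
  exact hz2 ⟨⟨hz3, hz1⟩, hz4⟩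

/-! ### Every point of the circle is an accumulation point -/

theorem elB_pow_smul (n : ℕ) (x : Fin 3 → ℂ) :
    elB ^ n • symCoord x = symCoord (symAct 1 (2 * n) 0 1 x) := by
  induction n with
  | zero => simp [symAct_one]
  | succ n ih =>
    rw [pow_succ', mul_smul, ih, elB_smul, symAct_symAct]
    push_cast
    congr 2 <;> ring

theorem tendsto_elB_pow_smul {x : CP2} (hx : x ∈ HC2) :
    Tendsto (fun n : ℕ => elB ^ (n + 1) • x) atTop (𝓝 pB) := by
  obtain ⟨x, hx₀, rfl, h⟩ := exists_eq_symPt_of_mem_HC2 hx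
  -- If `x₂ = 0`, the form reduces to `-2|x₁|² ≤ 0`, contradicting negativity of the line.
  have hc : x 2 ≠ 0 := by
    intro hc
    have : 0 ≤ (star (x 1) * x 1).re := by
      simp only [Complex.star_def, Complex.mul_re, Complex.conj_re, Complex.conj_im]
      nlinarith [sq_nonneg (x 1).re, sq_nonneg (x 1).im]
    simp [hc] at h this
    linarith
  have hne : ∀ n : ℕ, symAct 1 (2 * ((n + 1 : ℕ) : ℂ)) 0 1 x ≠ 0 := fun n =>
    ne_zero_of_smul_symCoord hx₀ (elB_pow_smul (n + 1) x)
  -- Rescaling the lift by `ε² = (n + 1)⁻²` isolates the leading coefficient `4 x₂`; the shift by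
  -- one keeps `ε` nonzero and `ε * (n + 1) = 1`.
  let ε : ℕ → ℂ := fun n => 1 / ((n : ℂ) + 1)
  have hε : Tendsto ε atTop (𝓝 0) := tendsto_one_div_add_atTop_nhds_zero_nat
  have hε0 : ∀ n, ε n ≠ 0 := fun n => one_div_ne_zero (by exact_mod_cast n.succ_ne_zero)
  have hlim : Tendsto (fun n => ![ε n ^ 2 * x 0 + 4 * ε n * x 1 + 4 * x 2,
      ε n ^ 2 * x 1 + 2 * ε n * x 2, ε n ^ 2 * x 2]) atTop (𝓝 ![4 * x 2, 0, 0]) := by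
    have hcont : Continuous fun e : ℂ => ![e ^ 2 * x 0 + 4 * e * x 1 + 4 * x 2,
      e ^ 2 * x 1 + 2 * e * x 2, e ^ 2 * x 2] := by
      refine continuous_pi fun i => ?_
      fin_cases i <;> simp <;> fun_prop
    have h0 := hcont.tendsto 0
    simp only [zero_pow two_ne_zero, mul_zero, zero_mul, zero_add, add_zero] at h0
    exact h0.comp hε
  have heq : ∀ n, ε n ^ 2 • symAct 1 (2 * ((n + 1 : ℕ) : ℂ)) 0 1 x =
      ![ε n ^ 2 * x 0 + 4 * ε n * x 1 + 4 * x 2, ε n ^ 2 * x 1 + 2 * ε n * x 2,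
        ε n ^ 2 * x 2] := by
    intro n
    have h1 : ε n * ((n : ℂ) + 1) = 1 :=
      one_div_mul_cancel (by exact_mod_cast n.succ_ne_zero)
    ext i
    fin_cases i <;> simp [symAct]
    · linear_combination (4 * ε n * x 1 + 4 * x 2 * (ε n * ((n : ℂ) + 1) + 1)) * h1
    · linear_combination (2 * ε n * x 2) * h1
  have hne' : ∀ n, ![ε n ^ 2 * x 0 + 4 * ε n * x 1 + 4 * x 2, ε n ^ 2 * x 1 + 2 * ε n * x 2,
      ε n ^ 2 * x 2] ≠ 0 := fun n => heq n ▸ smul_ne_zero (pow_ne_zero 2 (hε0 n)) (hne n)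
  have hne0 : (![4 * x 2, 0, 0] : Fin 3 → ℂ) ≠ 0 := fun h => hc (by simpa using congrFun h 0)
  have hpB : pB = symPt _ hne0 := by
    rw [pB_eq_symPt, Eq.comm, symPt_eq_symPt_iff]
    exact ⟨4 * x 2, by ext i; fin_cases i <;> simp⟩
  rw [hpB]
  refine (tendsto_symPt hne' hne0 hlim).congr fun n => ?_
  rw [smul_symPt hx₀ (hne n) (elB_pow_smul (n + 1) x), symPt_eq_symPt_iff]
  exact ⟨_, heq n⟩

theorem smul_pB_mem_derivedSet {x : CP2} (hx : x ∈ HC2) {g : SpecialLinearGroup (Fin 3) ℂ}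
    (hg : g ∈ GammaPrime) : g • pB ∈ derivedSet (orbitOf GammaPrime x) := by
  have hlim : Tendsto (fun n : ℕ => g • elB ^ (n + 1) • x) atTop (𝓝 (g • pB)) :=
    ((continuous_smul_CP2 g).tendsto pB).comp (tendsto_elB_pow_smul hx)
  rw [mem_derivedSet, accPt_iff_nhds]
  intro U hU
  obtain ⟨n, hn⟩ := (hlim.eventually hU).exists
  refine ⟨_, ⟨hn, g * elB ^ (n + 1), mul_mem hg (pow_mem elB_mem _), (mul_smul _ _ _).symm⟩, ?_⟩
  -- The limit `g • pB` lies on the circle and the orbit stays off it, so the approximating points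
  -- differ from the limit.
  intro h
  have h1 : g • pB ∈ veroneseCircle :=
    (smul_mem_veroneseCircle_iff hg _).2 pB_mem_veroneseCircle
  rw [← h, smul_mem_veroneseCircle_iff hg,
    smul_mem_veroneseCircle_iff (pow_mem elB_mem _)] at h1
  exact notMem_veroneseCircle_of_mem_HC2 hx h1

/-- Descent on `|p| + |r|`: replace the larger entry by its sum or difference with twice the
smaller. Parity is preserved and rules out `|p| = |r|`, so each step strictly decreases until `r =
0` and `p = ±1`. -/
theorem exists_smul_eq_of_isCoprime (n : ℕ) : ∀ p r : ℤ, p.natAbs + r.natAbs ≤ n →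
    IsCoprime p r → Odd p → Even r → ∃ g ∈ GammaPrime,
      g • symCoord ![1, 0, 0] = symCoord ![(p : ℂ) ^ 2, p * r, (r : ℂ) ^ 2] := by
  induction n with
  | zero =>
    intro p r h _ hp _
    obtain rfl : p = 0 := by omega
    simp at hp
  | succ n ih =>
    intro p r h hpr hp hr
    have hB : ∀ k : ℤ, p.natAbs + r.natAbs > (p + k * r).natAbs + r.natAbs → Even k →
        (elB • symCoord ![((p + k * r : ℤ) : ℂ) ^ 2, (p + k * r : ℤ) * r, (r : ℂ) ^ 2] =
          symCoord ![(p : ℂ) ^ 2, p * r, (r : ℂ) ^ 2] ∨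
        elB⁻¹ • symCoord ![((p + k * r : ℤ) : ℂ) ^ 2, (p + k * r : ℤ) * r, (r : ℂ) ^ 2] =
          symCoord ![(p : ℂ) ^ 2, p * r, (r : ℂ) ^ 2]) →
        ∃ g ∈ GammaPrime, g • symCoord ![1, 0, 0] =
          symCoord ![(p : ℂ) ^ 2, p * r, (r : ℂ) ^ 2] := by
      intro k hk hk2 he
      obtain ⟨g, hg, e⟩ := ih (p + k * r) r (by omega) (IsCoprime.add_mul_right_left hpr k)
        (hp.add_even (hk2.mul_right r)) hr
      rcases he with he | he
      · exact ⟨elB * g, mul_mem elB_mem hg, by rw [mul_smul, e, he]⟩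
      · exact ⟨elB⁻¹ * g, mul_mem (inv_mem elB_mem) hg, by rw [mul_smul, e, he]⟩
    have hC : ∀ k : ℤ, p.natAbs + r.natAbs > p.natAbs + (r + k * p).natAbs → Even k →
        (elC • symCoord ![(p : ℂ) ^ 2, p * (r + k * p : ℤ), ((r + k * p : ℤ) : ℂ) ^ 2] =
          symCoord ![(p : ℂ) ^ 2, p * r, (r : ℂ) ^ 2] ∨
        elC⁻¹ • symCoord ![(p : ℂ) ^ 2, p * (r + k * p : ℤ), ((r + k * p : ℤ) : ℂ) ^ 2] =
          symCoord ![(p : ℂ) ^ 2, p * r, (r : ℂ) ^ 2]) →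
        ∃ g ∈ GammaPrime, g • symCoord ![1, 0, 0] =
          symCoord ![(p : ℂ) ^ 2, p * r, (r : ℂ) ^ 2] := by
      intro k hk hk2 he
      obtain ⟨g, hg, e⟩ := ih p (r + k * p) (by omega) (IsCoprime.add_mul_right_right hpr k)
        hp (hr.add (hk2.mul_right p))
      rcases he with he | he
      · exact ⟨elC * g, mul_mem elC_mem hg, by rw [mul_smul, e, he]⟩
      · exact ⟨elC⁻¹ * g, mul_mem (inv_mem elC_mem) hg, by rw [mul_smul, e, he]⟩
    obtain ⟨i, hi⟩ := hp
    obtain ⟨j, hj⟩ := hr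
    rcases eq_or_ne r 0 with rfl | hr0
    · refine ⟨1, one_mem _, ?_⟩
      have hp2 : p ^ 2 = 1 := by
        rw [isCoprime_zero_right, Int.isUnit_iff] at hpr
        rcases hpr with rfl | rfl <;> norm_num
      have : (p : ℂ) ^ 2 = 1 := by exact_mod_cast hp2
      simp [this]
    · by_cases hlt : r.natAbs < p.natAbs
      · by_cases hs : 0 < p * r
        · refine hB (-2) ?_ (by decide) (Or.inl ?_)
          · rcases pos_and_pos_or_neg_and_neg_of_mul_pos hs with ⟨_, _⟩ | ⟨_, _⟩ <;> omega
          · rw [elB_smul]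
            congr 1
            ext i
            fin_cases i <;> simp [symAct] <;> ring
        · refine hB 2 ?_ (by decide) (Or.inr ?_)
          · rcases mul_nonpos_iff.1 (not_lt.1 hs) with ⟨_, _⟩ | ⟨_, _⟩ <;> omega
          · rw [elB_inv_smul]
            congr 1
            ext i
            fin_cases i <;> simp [symAct] <;> ring
      · by_cases hs : 0 < p * r
        · refine hC (-2) ?_ (by decide) (Or.inr ?_)
          · rcases pos_and_pos_or_neg_and_neg_of_mul_pos hs with ⟨_, _⟩ | ⟨_, _⟩ <;> omega
          · rw [elC_inv_smul]
            congr 1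
            ext i
            fin_cases i <;> simp [symAct] <;> ring
        · refine hC 2 ?_ (by decide) (Or.inl ?_)
          · rcases mul_nonpos_iff.1 (not_lt.1 hs) with ⟨_, _⟩ | ⟨_, _⟩ <;> omega
          · rw [elC_smul]
            congr 1
            ext i
            fin_cases i <;> simp [symAct] <;> ring

/-- An odd numerator over a positive power of two is automatically a coprime odd/even pair, so these
points lie in the orbit of `[p_B]`. -/
theorem veronese_mem_derivedSet_of_dyadic {x : CP2} (hx : x ∈ HC2) (k : ℤ) (m : ℕ) :
    symPt _ (veronese_ne_zero ((2 * k + 1) / 2 ^ (m + 1))) ∈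
      derivedSet (orbitOf GammaPrime x) := by
  have hcop : IsCoprime (2 * k + 1) (2 ^ (m + 1) : ℤ) :=
    IsCoprime.pow_right ⟨1, -k, by ring⟩
  obtain ⟨g, hg, h⟩ := exists_smul_eq_of_isCoprime _ (2 * k + 1) (2 ^ (m + 1)) le_rfl hcop
    ⟨k, rfl⟩ ((even_two).pow_of_ne_zero (Nat.succ_ne_zero m))
  have := smul_pB_mem_derivedSet hx hg
  rw [pB_eq_symPt, smul_symPt _ (ne_zero_of_smul_symCoord vec_one_ne_zero h) h] at this
  convert this using 1
  rw [symPt_eq_symPt_iff]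
  refine ⟨((2 : ℂ) ^ (m + 1))⁻¹ ^ 2, ?_⟩
  have h2 : (2 : ℂ) ^ (m + 1) ≠ 0 := pow_ne_zero _ two_ne_zero
  ext i
  fin_cases i <;> simp <;> field_simp

/-- The approximants are midpoints of the dyadic intervals of length `2⁻ᵐ` containing `y`; taking
midpoints makes the numerator odd. -/
theorem tendsto_dyadic (y : ℝ) :
    Tendsto (fun m : ℕ => (2 * (⌊y * 2 ^ m⌋ : ℝ) + 1) / 2 ^ (m + 1)) atTop (𝓝 y) := by
  rw [tendsto_iff_norm_sub_tendsto_zero]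
  refine squeeze_zero (fun _ => norm_nonneg _) (g := fun m : ℕ => (1 / 2 : ℝ) ^ m) (fun m => ?_)
    (tendsto_pow_atTop_nhds_zero_of_lt_one (by norm_num) (by norm_num))
  have h2 : (0 : ℝ) < 2 ^ m := by positivity
  have h1 := Int.floor_le (y * 2 ^ m)
  have h3 := Int.lt_floor_add_one (y * 2 ^ m)
  have e : (2 * (⌊y * 2 ^ m⌋ : ℝ) + 1) / 2 ^ (m + 1) - y =
      (⌊y * 2 ^ m⌋ + 1 / 2 - y * 2 ^ m) / 2 ^ m := by
    rw [pow_succ]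
    field_simp
  rw [e, Real.norm_eq_abs, abs_div, abs_of_pos h2, div_pow, one_pow]
  gcongr
  rw [abs_le]
  constructor <;> linarith

theorem veroneseCircle_subset_derivedSet {x : CP2} (hx : x ∈ HC2) :
    veroneseCircle ⊆ derivedSet (orbitOf GammaPrime x) := by
  intro p hp
  obtain rfl | ⟨y, rfl⟩ := (mem_veroneseCircle_iff p).1 hp
  · rw [← pB_eq_symPt]
    simpa using smul_pB_mem_derivedSet hx (one_mem GammaPrime)
  · refine (isClosed_derivedSet _).mem_of_tendsto (b := atTop) (tendsto_symPt
      (fun m : ℕ => veronese_ne_zero ((2 * (⌊y * 2 ^ m⌋ : ℝ) + 1) / 2 ^ (m + 1)))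
      (veronese_ne_zero y) ?_) (Eventually.of_forall fun m =>
        veronese_mem_derivedSet_of_dyadic hx ⌊y * 2 ^ m⌋ m)
    have hcont : Continuous fun y : ℝ => ![(y : ℂ) ^ 2, (y : ℂ), 1] := by
      refine continuous_pi fun i => ?_
      fin_cases i <;> simp <;> fun_prop
    exact (hcont.tendsto y).comp (tendsto_dyadic y)

theorem isLimitSet_veroneseCircle : IsLimitSet GammaPrime veroneseCircle := fun _ hx =>
  (derivedSet_orbitOf_subset hx).antisymm (veroneseCircle_subset_derivedSet hx)

end CHyp

theorem mainTheorem5 :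
    CHyp.elV ^ 3 * CHyp.elB * (CHyp.elV ^ 3)⁻¹ * CHyp.elB = CHyp.elB₁ ∧
    CHyp.GammaPrime = Subgroup.closure {CHyp.elB, CHyp.elA * CHyp.elB ^ 2 * CHyp.elA⁻¹} ∧
    CHyp.GammaPrime ≤ CHyp.Gamma6 ∧
    ∃ R₀ : Set CHyp.CP2,
      (CHyp.IsRCircle R₀ ∧
        CHyp.pB ∈ R₀ ∧ CHyp.elB₁ • CHyp.pB ∈ R₀ ∧ CHyp.elB₁⁻¹ • CHyp.pB ∈ R₀) ∧
      (∀ R : Set CHyp.CP2, CHyp.IsRCircle R → CHyp.pB ∈ R → CHyp.elB₁ • CHyp.pB ∈ R →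
        CHyp.elB₁⁻¹ • CHyp.pB ∈ R → R = R₀) ∧
      (∀ g ∈ CHyp.GammaPrime, (fun p : CHyp.CP2 => g • p) '' R₀ = R₀) ∧
      CHyp.IsLimitSet CHyp.GammaPrime R₀ := by
  refine ⟨CHyp.elC_mul_elB, CHyp.GammaPrime_eq_closure, CHyp.GammaPrime_le_Gamma6,
    CHyp.veroneseCircle, ⟨CHyp.isRCircle_veroneseCircle, CHyp.pB_mem_veroneseCircle, ?_, ?_⟩,
    fun R hR h₀ h₁ h₂ => hR.eq_veroneseCircle h₀ h₁ h₂,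
    fun g hg => CHyp.image_smul_veroneseCircle hg, CHyp.isLimitSet_veroneseCircle⟩
  · exact (CHyp.smul_mem_veroneseCircle_iff CHyp.elB₁_mem _).2 CHyp.pB_mem_veroneseCircle
  · exact (CHyp.smul_mem_veroneseCircle_iff (inv_mem CHyp.elB₁_mem) _).2
      CHyp.pB_mem_veroneseCircle
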